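/- Let $\mathbb S=\{I\in\mathbb H : I^2=-1\}$ be the sphere of imaginary units of the quaternions, and for $x\in\mathbb H\setminus\mathbb R$ put $\mathcal J(x)=\operatorname{Im}(x)/|\operatorname{Im}(x)|$. For $J\in\mathbb S$ define $\ell^{\pm,J}:\mathbb H\setminus\mathbb R\to\mathbb H$ by $$\ell^{+,J}(x)=\frac{1-\mathcal J(x)J}{2},\qquad \ell^{-,J}(x)=\frac{1+\mathcal J(x)J}{2}.$$ For $q\in\mathbb H\setminus\mathbb R$ let $\Delta_q(x)=x^2-x(q+q^c)+qq^c$, where $q^c$ is the conjugate of $q$, and for $R>0$ let $U(q,R)=\{x\in\mathbb H: |\Delta_q(x)|<R^2\}$ (a Cassini ball). If $f$ is a slice regular function on a circularization $\Omega_D=\{\alpha+I\beta : \alpha+i\beta\in D,\ I\in\mathbb S\}$ of an open set $D=\overline D\subset\mathbb C$ (that is, $f(\alpha+I\beta)=F_0(\alpha+i\beta)+I\,F_1(\alpha+i\beta)$ for $\alpha+i\beta\in D$, $I\in\mathbb S$, with $F_0+\sqrt{-1}F_1:D\to\mathbb H\otimes\mathbb C$ holomorphic, $F_0(\bar z)=F_0(z)$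 and $F_1(\bar z)=-F_1(z)$) and $q\in\Omega_D\setminus\mathbb R$, the spherical coefficients of $f$ at $q$ are the $s_n\in\mathbb H$ such that $$f(x)=\sum_{n\ge 0}\Delta_q(x)^n\,[\,s_{2n}+(x-q)s_{2n+1}\,]$$ for all $x$ in some Cassini ball $U(q,R)\subset\Omega_D$, $R>0$. **Corollary.** Let $J\in\mathbb S$ and $q=\alpha+I\beta\in\mathbb H\setminus\mathbb R$ with $I\in\mathbb S$, $\alpha\in\mathbb R$ and $\beta>0$. Then $\ell^{+,J}$ and $\ell^{-,J}$ are slice regular on $\mathbb H\setminus\mathbb R$, and their spherical coefficients $s_n^{\pm}$ at $q$ exist, are unique and are given by $$s_0^{\pm}=\frac{1\mp IJ}{2},\qquad s_{2k}^{\pm}=\mp\frac{1}{k!}\frac{(2k-1)!!}{2^{k+1}}\frac{1}{\beta^{2k}}\,IJ\quad(k\ge 1),\qquad s_{2k+1}^{\pm}=\mp\frac{1}{k!}\frac{(2k-1)!!}{2^{k+1}}\frac{1}{\beta^{2k+1}}\,J\quad(k\ge 0),$$ with the convention $(-1)!!=1$. Moreover, the resulting expansions hold on every Cassini ball $U(q,R)\subset\mathbb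 H\setminus\mathbb R$, $R>0$. -/

import Mathlib

open scoped Quaternion Nat

namespace SliceReg

/-- The sphere `𝕊` of imaginary units of the quaternions. -/
def imUnits : Set ℍ[ℝ] := {x | x ^ 2 = -1}

/-- The set `ℍ ∖ ℝ` of non-real quaternions. -/
def nonReal : Set ℍ[ℝ] := {x | x ∉ Set.range (fun r : ℝ => (r : ℍ[ℝ]))}

/-- The circularization `Ω_D = {α + Iβ : α + iβ ∈ D, I ∈ 𝕊}` of `D ⊆ ℂ`. -/
def circularization (D : Set ℂ) : Set ℍ[ℝ] :=
  {x | ∃ z ∈ D, ∃ I ∈ imUnits, x = (z.re : ℍ[ℝ]) + I * (z.im : ℍ[ℝ])}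

/-- `F = F₀ + √-1 F₁ : D → ℍ ⊗ ℂ` is a stem function: `F (conj z) = conj (F z)` on `D`, where
`x + √-1 y ∈ ℍ ⊗ ℂ` is the pair `(x, y)` and its conjugate is `x - √-1 y`. -/
def IsStem (D : Set ℂ) (F₀ F₁ : ℂ → ℍ[ℝ]) : Prop :=
  ∀ z ∈ D, F₀ (starRingEnd ℂ z) = F₀ z ∧ F₁ (starRingEnd ℂ z) = -F₁ z

/-- `F = F₀ + √-1 F₁` induces the (left) slice function `f` on `Ω_D`:
`f (α + Iβ) = F₀ (α + iβ) + I F₁ (α + iβ)`. -/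
def Induces (D : Set ℂ) (F₀ F₁ : ℂ → ℍ[ℝ]) (f : ℍ[ℝ] → ℍ[ℝ]) : Prop :=
  ∀ z ∈ D, ∀ I ∈ imUnits, f ((z.re : ℍ[ℝ]) + I * (z.im : ℍ[ℝ])) = F₀ z + I * F₁ z

/-- `F = F₀ + √-1 F₁ : D → ℍ ⊗ ℂ` is holomorphic for the complex structure of `ℍ ⊗ ℂ` given by
multiplication by `√-1`: it is real differentiable and `∂F/∂β = √-1 ∂F/∂α`, i.e. the
Cauchy-Riemann equations `∂F₀/∂α = ∂F₁/∂β`, `∂F₀/∂β = -∂F₁/∂α` hold. -/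
def IsHolomorphicStem (D : Set ℂ) (F₀ F₁ : ℂ → ℍ[ℝ]) : Prop :=
  ∀ z ∈ D, DifferentiableAt ℝ F₀ z ∧ DifferentiableAt ℝ F₁ z ∧
    fderiv ℝ F₀ z 1 = fderiv ℝ F₁ z Complex.I ∧
    fderiv ℝ F₀ z Complex.I = -fderiv ℝ F₁ z 1

/-- `f` is (left) slice regular on `Ω`: here `Ω = Ω_D` for an open `D ⊆ ℂ` with `conj D = D`, and
`f` is induced on `Ω_D` by a holomorphic stem function on `D`. Only the values of `f` on `Ω`
matter. -/
def IsSliceRegularOn (Ω : Set ℍ[ℝ]) (f : ℍ[ℝ] → ℍ[ℝ]) : Prop :=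
  ∃ D : Set ℂ, IsOpen D ∧ (∀ z, z ∈ D ↔ starRingEnd ℂ z ∈ D) ∧ Ω = circularization D ∧
    ∃ F₀ F₁ : ℂ → ℍ[ℝ], IsStem D F₀ F₁ ∧ IsHolomorphicStem D F₀ F₁ ∧ Induces D F₀ F₁ f

/-- The characteristic polynomial `Δ_q(x) = x² - x (q + qᶜ) + q qᶜ`. -/
noncomputable def charPoly (q x : ℍ[ℝ]) : ℍ[ℝ] := x ^ 2 - x * (q + star q) + q * star q

/-- The Cassini ball `U(q, R) = {x : |Δ_q(x)| < R²}`. -/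
def cassiniBall (q : ℍ[ℝ]) (R : ℝ) : Set ℍ[ℝ] := {x | ‖charPoly q x‖ < R ^ 2}

/-- `f(x) = ∑ₙ Δ_q(x)ⁿ [s₂ₙ + (x - q) s₂ₙ₊₁]` for all `x ∈ U`. -/
def HasSphericalExpansionOn (U : Set ℍ[ℝ]) (f : ℍ[ℝ] → ℍ[ℝ]) (q : ℍ[ℝ]) (s : ℕ → ℍ[ℝ]) : Prop :=
  ∀ x ∈ U, HasSum (fun n : ℕ => charPoly q x ^ n * (s (2 * n) + (x - q) * s (2 * n + 1))) (f x)

/-- `s` is the sequence of spherical coefficients at the non-real point `q ∈ Ω` of the slice regular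
function `f : Ω → ℍ`: the spherical expansion with coefficients `s` represents `f` on some Cassini
ball around `q` contained in `Ω`. -/
def IsSphericalCoeffs (Ω : Set ℍ[ℝ]) (f : ℍ[ℝ] → ℍ[ℝ]) (q : ℍ[ℝ]) (s : ℕ → ℍ[ℝ]) : Prop :=
  IsSliceRegularOn Ω f ∧ q ∈ Ω ∩ nonReal ∧
    ∃ R : ℝ, 0 < R ∧ cassiniBall q R ⊆ Ω ∧ HasSphericalExpansionOn (cassiniBall q R) f q s

/-- The function `𝒥(x) = Im x / |Im x|`, considered on `ℍ ∖ ℝ` only. -/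
noncomputable def unitIm (x : ℍ[ℝ]) : ℍ[ℝ] := ‖x.im‖⁻¹ • x.im

/-- The idempotent function `ℓ^{+,J}(x) = (1 - 𝒥(x) J) / 2` on `ℍ ∖ ℝ`. -/
noncomputable def ellPlus (J x : ℍ[ℝ]) : ℍ[ℝ] := (1 / 2 : ℝ) • (1 - unitIm x * J)

/-- The idempotent function `ℓ^{-,J}(x) = (1 + 𝒥(x) J) / 2` on `ℍ ∖ ℝ`. -/
noncomputable def ellMinus (J x : ℍ[ℝ]) : ℍ[ℝ] := (1 / 2 : ℝ) • (1 + unitIm x * J)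

/-- The number `(1 / k!) (2k-1)!! / 2^(k+1)`, with `(-1)!! = 1`. -/
noncomputable def coeffConst (k : ℕ) : ℝ :=
  1 / (k ! : ℝ) * (((2 * k - 1)‼ : ℕ) : ℝ) / 2 ^ (k + 1)

end SliceReg

/-!
On the Cassini ball of radius `|Im q|` the function `𝒥` is a binomial series in `Δ_q`. Put
`α = Re q`, `β = |Im q|` and `K = 𝒥(x)`. All computations with `x` take place in the slice
`ℝ + Kℝ ≅ ℂ`, where `Δ_q(x) = (x - α)² + β²`, so `-K (x - α) / β` is the square root of
`1 - Δ_q(x) / β²` with positive real part, and `𝒥(x) = K = (x - α) / β * (1 - Δ_q(x) / β²)^(-1/2)`.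
Substituting `x - α = (x - q) + Im q` gives the spherical expansion of `𝒥`, and `ℓ^{±,J}` is a
right-affine function of `𝒥`.

For uniqueness, a real value `t < β²` of `Δ_q` is attained at two different points; comparing the
expansions there separates odd from even coefficients and leaves power series in `t`.
-/

namespace SliceReg

open Filter Topology

section ImaginaryUnits

variable {K : ℍ[ℝ]}

lemma norm_of_mem_imUnits (hK : K ∈ imUnits) : ‖K‖ = 1 := by
  have h : ‖K‖ ^ 2 = 1 := by rw [← norm_pow, show K ^ 2 = -1 from hK, norm_neg, norm_one]
  exact (pow_eq_one_iff_of_nonneg (norm_nonneg K) two_ne_zero).1 h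

lemma re_of_mem_imUnits (hK : K ∈ imUnits) : K.re = 0 := by
  rw [← Quaternion.sq_eq_neg_normSq, Quaternion.normSq_eq_norm_mul_self, norm_of_mem_imUnits hK,
    mul_one, Quaternion.coe_one]
  exact hK

lemma im_add_mul (hK : K ∈ imUnits) (a b : ℝ) :
    ((a : ℍ[ℝ]) + K * (b : ℍ[ℝ])).im = b • K := by
  ext <;> simp [re_of_mem_imUnits hK, mul_comm]

lemma norm_im_add_mul (hK : K ∈ imUnits) (a b : ℝ) :
    ‖((a : ℍ[ℝ]) + K * (b : ℍ[ℝ])).im‖ = |b| := by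
  rw [im_add_mul hK, norm_smul, norm_of_mem_imUnits hK, mul_one, Real.norm_eq_abs]

lemma unitIm_add_mul (hK : K ∈ imUnits) (a b : ℝ) :
    unitIm ((a : ℍ[ℝ]) + K * (b : ℍ[ℝ])) = (SignType.sign b : ℝ) • K := by
  rw [unitIm, norm_im_add_mul hK, im_add_mul hK, smul_smul]
  rcases eq_or_ne b 0 with rfl | hb
  · simp
  · rw [inv_mul_eq_iff_eq_mul₀ (abs_ne_zero.2 hb) |>.2 (abs_mul_sign b).symm]

end ImaginaryUnits

section NonReal

variable {x : ℍ[ℝ]}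

lemma mem_nonReal_iff : x ∈ nonReal ↔ x.im ≠ 0 := by
  refine not_congr ⟨?_, fun h => ⟨x.re, ?_⟩⟩
  · rintro ⟨r, rfl⟩
    exact Quaternion.im_coe r
  · simpa only [h, add_zero] using Quaternion.re_add_im x

lemma norm_im_pos (hx : x ∈ nonReal) : 0 < ‖x.im‖ :=
  norm_pos_iff.2 (mem_nonReal_iff.1 hx)

lemma unitIm_mem_imUnits (hx : x ∈ nonReal) : unitIm x ∈ imUnits := by
  change (‖x.im‖⁻¹ • x.im) ^ 2 = -1
  have hne := (norm_im_pos hx).ne'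
  rw [smul_pow, Quaternion.im_sq, Quaternion.normSq_eq_norm_mul_self, smul_neg,
    Quaternion.smul_coe, ← sq, ← mul_pow, inv_mul_cancel₀ hne, one_pow, Quaternion.coe_one]

lemma norm_im_smul_unitIm (x : ℍ[ℝ]) : ‖x.im‖ • unitIm x = x.im := by
  rcases eq_or_ne x.im 0 with h | h
  · simp [unitIm, h]
  · rw [unitIm, smul_inv_smul₀ (norm_ne_zero_iff.2 h)]

lemma re_add_unitIm_mul_norm_im (x : ℍ[ℝ]) :
    (x.re : ℍ[ℝ]) + unitIm x * (‖x.im‖ : ℍ[ℝ]) = x := by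
  rw [← Quaternion.coe_commutes, Quaternion.coe_mul_eq_smul, norm_im_smul_unitIm,
    Quaternion.re_add_im]

lemma add_mul_mem_nonReal {K : ℍ[ℝ]} (hK : K ∈ imUnits) (a : ℝ) {b : ℝ} (hb : b ≠ 0) :
    (a : ℍ[ℝ]) + K * (b : ℍ[ℝ]) ∈ nonReal := by
  rw [mem_nonReal_iff, ← norm_ne_zero_iff, norm_im_add_mul hK]
  exact abs_ne_zero.2 hb

lemma circularization_im_ne_zero : circularization {z : ℂ | z.im ≠ 0} = nonReal := by
  ext x
  constructor
  · rintro ⟨z, hz, K, hK, rfl⟩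
    exact add_mul_mem_nonReal hK _ hz
  · intro hx
    exact ⟨⟨x.re, ‖x.im‖⟩, (norm_im_pos hx).ne', unitIm x, unitIm_mem_imUnits hx,
      (re_add_unitIm_mul_norm_im x).symm⟩

end NonReal

section SliceHom

variable {K : ℍ[ℝ]}

/-- The embedding `a + ib ↦ a + Kb` of `ℂ` onto the slice `ℝ + Kℝ` of the quaternions, through which
complex power series are transported to `ℍ`. -/
noncomputable def sliceHom (hK : K ∈ imUnits) : ℂ →ₐ[ℝ] ℍ[ℝ] :=
  Complex.liftAux K ((sq K).symm.trans hK)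

lemma sliceHom_apply (hK : K ∈ imUnits) (z : ℂ) :
    sliceHom hK z = (z.re : ℍ[ℝ]) + K * (z.im : ℍ[ℝ]) := by
  rw [sliceHom, Complex.liftAux_apply, ← Quaternion.coe_mul_eq_smul, Quaternion.coe_commutes]
  rfl

lemma sliceHom_I (hK : K ∈ imUnits) : sliceHom hK Complex.I = K :=
  Complex.liftAux_apply_I K _

lemma sliceHom_ofReal (hK : K ∈ imUnits) (r : ℝ) : sliceHom hK (r : ℂ) = (r : ℍ[ℝ]) :=
  (sliceHom hK).commutes r

lemma norm_sliceHom (hK : K ∈ imUnits) (z : ℂ) : ‖sliceHom hK z‖ = ‖z‖ := by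
  have hstar : star (sliceHom hK z) = sliceHom hK (starRingEnd ℂ z) := by
    simp [sliceHom_apply, Quaternion.star_eq_neg.2 (re_of_mem_imUnits hK),
      Quaternion.coe_commutes]
  have hsq : ((‖sliceHom hK z‖ * ‖sliceHom hK z‖ : ℝ) : ℍ[ℝ]) = ((‖z‖ * ‖z‖ : ℝ) : ℍ[ℝ]) := by
    rw [← Quaternion.normSq_eq_norm_mul_self, ← Quaternion.self_mul_star, hstar, ← map_mul,
      Complex.mul_conj, sliceHom_ofReal, Complex.normSq_eq_norm_sq, sq]
  exact (mul_self_inj (norm_nonneg _) (norm_nonneg _)).1 (Quaternion.coe_injective hsq)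

end SliceHom

section SliceRegular

lemma IsSliceRegularOn.const_add_mul {Ω : Set ℍ[ℝ]} {f : ℍ[ℝ] → ℍ[ℝ]} (hf : IsSliceRegularOn Ω f)
    (c a : ℍ[ℝ]) : IsSliceRegularOn Ω fun x => c + f x * a := by
  obtain ⟨D, hD, hconj, hΩ, F₀, F₁, hstem, hhol, hind⟩ := hf
  refine ⟨D, hD, hconj, hΩ, fun z => c + F₀ z * a, fun z => F₁ z * a, fun z hz => ?_,
    fun z hz => ?_, fun z hz K hK => ?_⟩
  · simp only [hstem z hz, neg_mul, and_self]
  · obtain ⟨hd₀, hd₁, hre, him⟩ := hhol z hz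
    refine ⟨(hd₀.mul_const a).const_add c, hd₁.mul_const a, ?_⟩
    simp only [fderiv_const_add, fderiv_mul_const' hd₀, fderiv_mul_const' hd₁,
      smul_apply, hre, him, smul_neg, and_self]
  · simp only [hind z hz K hK, add_mul, mul_assoc, add_assoc]

lemma eventually_sign_im_eq {z : ℂ} (hz : z.im ≠ 0) :
    ∀ᶠ w : ℂ in 𝓝 z, SignType.sign w.im = SignType.sign z.im := by
  have h : ContinuousAt (fun w : ℂ => SignType.sign w.im) z :=
    (continuousAt_sign_of_ne_zero hz).comp Complex.continuous_im.continuousAt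
  rwa [ContinuousAt, nhds_discrete SignType, tendsto_pure] at h

theorem isSliceRegularOn_unitIm : IsSliceRegularOn nonReal unitIm := by
  refine ⟨{z : ℂ | z.im ≠ 0}, isOpen_ne.preimage Complex.continuous_im, fun z => by simp,
    circularization_im_ne_zero.symm, 0, fun z => (SignType.sign z.im : ℝ), fun z _ => ?_,
    fun z hz => ?_, fun z _ K hK => ?_⟩
  · simp [Left.sign_neg]
  · have hconst : (fun w : ℂ => ((SignType.sign w.im : ℝ) : ℍ[ℝ])) =ᶠ[𝓝 z]
        fun _ => ((SignType.sign z.im : ℝ) : ℍ[ℝ]) :=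
      (eventually_sign_im_eq hz).mono fun w hw => by simp only [hw]
    refine ⟨differentiableAt_const _, (differentiableAt_const _).congr_of_eventuallyEq hconst, ?_⟩
    simp [hconst.fderiv_eq]
  · rw [unitIm_add_mul hK, Pi.zero_apply, zero_add, ← Quaternion.coe_commutes,
      Quaternion.coe_mul_eq_smul]

end SliceRegular

section CassiniBall

lemma charPoly_eq_sq_add (q x : ℍ[ℝ]) :
    charPoly q x = (x - (q.re : ℍ[ℝ])) ^ 2 + ((‖q.im‖ ^ 2 : ℝ) : ℍ[ℝ]) := by
  rw [charPoly, sq ‖q.im‖, ← Quaternion.normSq_eq_norm_mul_self, Quaternion.normSq_def']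
  ext <;> simp [sq] <;> ring

lemma charPoly_coe (q : ℍ[ℝ]) (r : ℝ) :
    charPoly q r = (((r - q.re) ^ 2 + ‖q.im‖ ^ 2 : ℝ) : ℍ[ℝ]) := by
  rw [charPoly_eq_sq_add]
  norm_cast

lemma charPoly_sliceHom {K : ℍ[ℝ]} (hK : K ∈ imUnits) (q : ℍ[ℝ]) (z : ℂ) :
    charPoly q (sliceHom hK z) = sliceHom hK ((z - q.re) ^ 2 + (‖q.im‖ : ℂ) ^ 2) := by
  rw [charPoly_eq_sq_add, map_add, map_pow, map_sub, map_pow, sliceHom_ofReal, sliceHom_ofReal,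
    Quaternion.coe_pow]

lemma cassiniBall_subset_nonReal_iff {q : ℍ[ℝ]} {R : ℝ} :
    cassiniBall q R ⊆ nonReal ↔ R ^ 2 ≤ ‖q.im‖ ^ 2 := by
  have hmem (r : ℝ) : (r : ℍ[ℝ]) ∈ cassiniBall q R ↔ (r - q.re) ^ 2 + ‖q.im‖ ^ 2 < R ^ 2 := by
    change ‖charPoly q r‖ < R ^ 2 ↔ _
    rw [charPoly_coe, Quaternion.norm_coe, Real.norm_of_nonneg (by positivity)]
  constructor
  · intro hsub
    by_contra! h
    exact hsub ((hmem q.re).2 (by simpa using h)) ⟨q.re, rfl⟩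
  · rintro h _ hx ⟨r, rfl⟩
    linarith [(hmem r).1 hx, sq_nonneg (r - q.re)]

lemma cassiniBall_subset {q : ℍ[ℝ]} {r R : ℝ} (hr : 0 ≤ r) (h : r ≤ R) :
    cassiniBall q r ⊆ cassiniBall q R :=
  fun _ hx => lt_of_lt_of_le hx (pow_le_pow_left₀ hr h 2)

lemma exists_ne_charPoly_eq_coe (q : ℍ[ℝ]) {t : ℝ} (ht : t < ‖q.im‖ ^ 2) :
    ∃ x y : ℍ[ℝ], x ≠ y ∧ charPoly q x = t ∧ charPoly q y = t := by
  have hpos : 0 < ‖q.im‖ ^ 2 - t := sub_pos.2 ht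
  set y : ℍ[ℝ] := ⟨0, √(‖q.im‖ ^ 2 - t), 0, 0⟩ with hy
  have hy2 : y ^ 2 = ((t - ‖q.im‖ ^ 2 : ℝ) : ℍ[ℝ]) := by
    rw [Quaternion.sq_eq_neg_normSq.2 rfl, Quaternion.normSq_def', ← Quaternion.coe_neg]
    simp [hy, Real.sq_sqrt hpos.le]
  have hy0 : y ≠ -y := fun h => by
    have : √(‖q.im‖ ^ 2 - t) = 0 := self_eq_neg.1 (congrArg (fun p : ℍ[ℝ] => p.imI) h)
    exact (Real.sqrt_pos.2 hpos).ne' this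
  refine ⟨q.re + y, q.re + -y, fun h => hy0 (add_left_cancel h), ?_, ?_⟩ <;>
    simp only [charPoly_eq_sq_add, add_sub_cancel_left, neg_sq, hy2, ← Quaternion.coe_add,
      sub_add_cancel]

end CassiniBall

section SphericalExpansion

variable {U Ω : Set ℍ[ℝ]} {f g : ℍ[ℝ] → ℍ[ℝ]} {q : ℍ[ℝ]} {s s' : ℕ → ℍ[ℝ]}

lemma HasSphericalExpansionOn.mono {V : Set ℍ[ℝ]} (h : HasSphericalExpansionOn U f q s)
    (hVU : V ⊆ U) : HasSphericalExpansionOn V f q s :=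
  fun x hx => h x (hVU hx)

lemma HasSphericalExpansionOn.sub (hf : HasSphericalExpansionOn U f q s)
    (hg : HasSphericalExpansionOn U g q s') : HasSphericalExpansionOn U (f - g) q (s - s') := by
  intro x hx
  refine HasSum.congr_fun ((hf x hx).sub (hg x hx)) fun n => ?_
  simp only [Pi.sub_apply]
  noncomm_ring

lemma HasSphericalExpansionOn.const_add_mul (h : HasSphericalExpansionOn U f q s) (c a : ℍ[ℝ]) :
    HasSphericalExpansionOn U (fun x => c + f x * a) q
      (Pi.single 0 c + fun n => s n * a) := by
  intro x hx
  refine HasSum.congr_fun ((hasSum_pi_single 0 c).add ((h x hx).mul_right a)) fun n => ?_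
  have hodd : (Pi.single 0 c : ℕ → ℍ[ℝ]) (2 * n + 1) = 0 :=
    Pi.single_eq_of_ne (2 * n).succ_ne_zero c
  have heven : charPoly q x ^ n * (Pi.single 0 c : ℕ → ℍ[ℝ]) (2 * n) =
      (Pi.single 0 c : ℕ → ℍ[ℝ]) n := by
    rcases n with _ | n
    · simp
    · rw [Pi.single_eq_of_ne (by omega), Pi.single_eq_of_ne (by omega), mul_zero]
  simp only [Pi.add_apply, hodd, ← heven]
  noncomm_ring

lemma eq_zero_of_eventually_hasSum_pow_smul_zero {𝕜 E : Type*} [NontriviallyNormedField 𝕜]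
    [NormedAddCommGroup E] [NormedSpace 𝕜 E] {a : ℕ → E}
    (h : ∀ᶠ t : 𝕜 in 𝓝 0, HasSum (fun n => t ^ n • a n) 0) : a = 0 := by
  let p : FormalMultilinearSeries 𝕜 𝕜 E :=
    fun n => ContinuousMultilinearMap.mkPiRing 𝕜 (Fin n) (a n)
  have hcoeff (n : ℕ) : p.coeff n = a n := by simp [p, FormalMultilinearSeries.coeff]
  have hp : HasFPowerSeriesAt (0 : 𝕜 → E) p 0 := by
    rw [hasFPowerSeriesAt_iff]
    simpa [hcoeff] using h
  funext n
  rw [← hcoeff, hp.eq_zero]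
  rfl

lemma HasSphericalExpansionOn.eq_zero {R : ℝ} (hq : q ∈ nonReal) (hR : 0 < R)
    (h : HasSphericalExpansionOn (cassiniBall q R) 0 q s) : s = 0 := by
  have hsum {t : ℝ} (ht : |t| < R ^ 2) {x : ℍ[ℝ]} (hx : charPoly q x = t) :
      HasSum (fun n => t ^ n • (s (2 * n) + (x - q) * s (2 * n + 1))) 0 := by
    have hmem : x ∈ cassiniBall q R := by
      change ‖charPoly q x‖ < R ^ 2
      rwa [hx, Quaternion.norm_coe]
    simpa only [hx, ← Quaternion.coe_pow, Quaternion.coe_mul_eq_smul, Pi.zero_apply] using h x hmem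
  have hsmall : ∀ᶠ t : ℝ in 𝓝 0, |t| < R ^ 2 ∧ t < ‖q.im‖ ^ 2 :=
    (continuous_abs.continuousAt.eventually_lt_const (by simpa using pow_pos hR 2)).and
      (eventually_lt_nhds (pow_pos (norm_im_pos hq) 2))
  have hodd : (fun n => s (2 * n + 1)) = 0 := by
    refine eq_zero_of_eventually_hasSum_pow_smul_zero (𝕜 := ℝ) ?_
    filter_upwards [hsmall] with t ⟨htR, htq⟩
    obtain ⟨x, y, hxy, hx, hy⟩ := exists_ne_charPoly_eq_coe q htq
    have hdiff := ((hsum htR hx).sub (hsum htR hy)).mul_left (x - y)⁻¹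
    rw [sub_zero, mul_zero] at hdiff
    refine hdiff.congr_fun fun n => ?_
    rw [← smul_sub, add_sub_add_left_eq_sub, ← sub_mul, sub_sub_sub_cancel_right, mul_smul_comm,
      inv_mul_cancel_left₀ (sub_ne_zero.2 hxy)]
  have heven : (fun n => s (2 * n)) = 0 := by
    refine eq_zero_of_eventually_hasSum_pow_smul_zero (𝕜 := ℝ) ?_
    filter_upwards [hsmall] with t ⟨htR, htq⟩
    obtain ⟨x, -, -, hx, -⟩ := exists_ne_charPoly_eq_coe q htq
    simpa only [congrFun hodd, Pi.zero_apply, mul_zero, add_zero] using hsum htR hx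
  funext n
  obtain ⟨k, rfl | rfl⟩ := n.even_or_odd'
  · exact congrFun heven k
  · exact congrFun hodd k

theorem IsSphericalCoeffs.unique (h : IsSphericalCoeffs Ω f q s)
    (h' : IsSphericalCoeffs Ω f q s') : s = s' := by
  obtain ⟨-, ⟨-, hq⟩, R, hR, -, hs⟩ := h
  obtain ⟨-, -, R', hR', -, hs'⟩ := h'
  have hmin : 0 < min R R' := lt_min hR hR'
  have hdiff := (hs.mono (cassiniBall_subset hmin.le (min_le_left R R'))).sub
    (hs'.mono (cassiniBall_subset hmin.le (min_le_right R R')))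
  rw [sub_self] at hdiff
  exact sub_eq_zero.1 (hdiff.eq_zero hq hmin)

end SphericalExpansion

section BinomialSeries

lemma coeffConst_zero : coeffConst 0 = 1 / 2 := by
  simp [coeffConst]

lemma coeffConst_succ (n : ℕ) :
    (n + 1) * coeffConst (n + 1) = (1 / 2 + n) * coeffConst n := by
  have h : (2 * (n + 1) - 1)‼ = (2 * n + 1) * (2 * n - 1)‼ := Nat.doubleFactorial_add_one (2 * n)
  rw [coeffConst, coeffConst, h, Nat.factorial_succ]
  push_cast
  field_simp
  ring

lemma choose_half_add_sub_one (n : ℕ) :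
    Ring.choose ((1 / 2 : ℂ) + n - 1) n = ((2 * coeffConst n : ℝ) : ℂ) := by
  have hf : (n ! : ℂ) ≠ 0 := by exact_mod_cast n.factorial_ne_zero
  apply mul_left_cancel₀ hf
  rw [← Ring.multichoose_eq, ← nsmul_eq_mul, Ring.factorial_nsmul_multichoose_eq_ascPochhammer,
    Polynomial.ascPochhammer_smeval_eq_eval]
  induction n with
  | zero => simp [coeffConst_zero]
  | succ n ih =>
    rw [ascPochhammer_succ_eval, ih (by exact_mod_cast n.factorial_ne_zero), Nat.factorial_succ]
    have h := congrArg (fun r : ℝ => (r : ℂ)) (coeffConst_succ n)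
    push_cast at h ⊢
    linear_combination (-2 * (n ! : ℂ)) * h

lemma hasSum_one_div_one_sub_cpow_half {u : ℂ} (hu : ‖u‖ < 1) :
    HasSum (fun n : ℕ => ((2 * coeffConst n : ℝ) : ℂ) * u ^ n) (1 / (1 - u) ^ (1 / 2 : ℂ)) := by
  have hs := (Complex.one_div_one_sub_cpow_hasFPowerSeriesOnBall_zero (1 / 2)).hasSum (y := u)
    (by simpa [enorm_eq_nnnorm, ← NNReal.coe_lt_coe] using hu)
  simpa only [FormalMultilinearSeries.ofScalars_apply_eq, choose_half_add_sub_one, smul_eq_mul,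
    zero_add] using hs

lemma hasSum_I {b : ℝ} (hb : 0 < b) {w : ℂ} (hw : 0 < w.im) (h : ‖w ^ 2 + (b : ℂ) ^ 2‖ < b ^ 2) :
    HasSum (fun n : ℕ => (2 * coeffConst n / b ^ (2 * n + 1)) • ((w ^ 2 + (b : ℂ) ^ 2) ^ n * w))
      Complex.I := by
  have hb0 : (b : ℂ) ≠ 0 := Complex.ofReal_ne_zero.2 hb.ne'
  have hw0 : w ≠ 0 := fun h0 => by simp [h0] at hw
  set v : ℂ := w ^ 2 + (b : ℂ) ^ 2 with hv
  have hu : ‖v / (b : ℂ) ^ 2‖ < 1 := by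
    rw [norm_div, norm_pow, Complex.norm_real, Real.norm_of_nonneg hb.le]
    exact (div_lt_one (by positivity)).2 h
  have hroot : (1 - v / (b : ℂ) ^ 2) ^ (1 / 2 : ℂ) = -Complex.I * w / b := by
    have hsq : 1 - v / (b : ℂ) ^ 2 = (-Complex.I * w / b) ^ 2 := by
      rw [hv]
      field_simp
      linear_combination -w ^ 2 * Complex.I_sq
    have hre : 0 < (-Complex.I * w / b).re := by
      rw [Complex.div_ofReal_re]
      exact div_pos (by simpa using hw) hb
    rw [hsq, one_div, Complex.sq_cpow_two_inv hre]
  have hs := (hasSum_one_div_one_sub_cpow_half hu).mul_right (w / b)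
  have hlim : 1 / (-Complex.I * w / b) * (w / b) = Complex.I := by
    field_simp
    linear_combination -Complex.I_sq
  rw [hroot, hlim] at hs
  refine hs.congr_fun fun n => ?_
  rw [Complex.real_smul]
  push_cast
  rw [div_pow, ← pow_mul, pow_succ]
  field_simp

end BinomialSeries

section UnitIm

variable {q : ℍ[ℝ]}

lemma hasSum_unitIm {x : ℍ[ℝ]} (hq : q ∈ nonReal) (hx : x ∈ nonReal)
    (h : ‖charPoly q x‖ < ‖q.im‖ ^ 2) :
    HasSum (fun n : ℕ => (2 * coeffConst n / ‖q.im‖ ^ (2 * n + 1)) •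
      (charPoly q x ^ n * (x - (q.re : ℍ[ℝ])))) (unitIm x) := by
  have hK := unitIm_mem_imUnits hx
  set z : ℂ := ⟨x.re, ‖x.im‖⟩
  have hz : sliceHom hK z = x := (sliceHom_apply hK z).trans (re_add_unitIm_mul_norm_im x)
  have hΔ : sliceHom hK ((z - q.re) ^ 2 + (‖q.im‖ : ℂ) ^ 2) = charPoly q x := by
    rw [← charPoly_sliceHom, hz]
  have him : 0 < (z - q.re).im := by simpa [z] using norm_im_pos hx
  have hsum := (hasSum_I (norm_im_pos hq) him (by rwa [← norm_sliceHom hK, hΔ])).map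
    (sliceHom hK).toLinearMap (sliceHom hK).toLinearMap.continuous_of_finiteDimensional
  simpa only [Function.comp_def, AlgHom.toLinearMap_apply, map_smul, map_mul, map_pow, map_sub, hz,
    hΔ, sliceHom_ofReal, sliceHom_I] using hsum

/-- The spherical coefficients of `𝒥` at a non-real point `q`. The even and the odd ones are
given together: `n / 2` is the `k` of `n = 2k` or `n = 2k + 1`. -/
noncomputable def unitImCoeff (q : ℍ[ℝ]) (n : ℕ) : ℍ[ℝ] :=
  (2 * coeffConst (n / 2) / ‖q.im‖ ^ n) • if Even n then unitIm q else 1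

lemma unitImCoeff_two_mul (q : ℍ[ℝ]) (k : ℕ) :
    unitImCoeff q (2 * k) = (2 * coeffConst k / ‖q.im‖ ^ (2 * k)) • unitIm q := by
  simp [unitImCoeff]

lemma unitImCoeff_two_mul_add_one (q : ℍ[ℝ]) (k : ℕ) :
    unitImCoeff q (2 * k + 1) = (2 * coeffConst k / ‖q.im‖ ^ (2 * k + 1)) • 1 := by
  simp [unitImCoeff, Nat.mul_add_div]

theorem hasSphericalExpansionOn_unitIm {R : ℝ} (hq : q ∈ nonReal)
    (hR : cassiniBall q R ⊆ nonReal) :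
    HasSphericalExpansionOn (cassiniBall q R) unitIm q (unitImCoeff q) := by
  intro x hx
  have hΔ : ‖charPoly q x‖ < ‖q.im‖ ^ 2 :=
    lt_of_lt_of_le hx (cassiniBall_subset_nonReal_iff.1 hR)
  refine HasSum.congr_fun (hasSum_unitIm hq (hR hx) hΔ) fun n => ?_
  have heven : (2 * coeffConst n / ‖q.im‖ ^ (2 * n)) • unitIm q =
      (2 * coeffConst n / ‖q.im‖ ^ (2 * n + 1)) • q.im := by
    nth_rw 3 [← norm_im_smul_unitIm q]
    rw [smul_smul, pow_succ, ← div_div, div_mul_cancel₀ _ (norm_im_pos hq).ne']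
  rw [unitImCoeff_two_mul, unitImCoeff_two_mul_add_one, heven, mul_smul_comm, mul_one, ← smul_add,
    ← Quaternion.sub_re_self q, sub_add_sub_cancel', mul_smul_comm]

end UnitIm

section EllPlus

variable {q : ℍ[ℝ]}

lemma ellPlus_eq_const_add_unitIm_mul (J : ℍ[ℝ]) :
    ellPlus J = fun x => (1 / 2 : ℝ) • 1 + unitIm x * -((1 / 2 : ℝ) • J) := by
  funext x
  rw [ellPlus, smul_sub, mul_neg, mul_smul_comm, sub_eq_add_neg]

lemma ellMinus_eq_ellPlus_neg (J : ℍ[ℝ]) : ellMinus J = ellPlus (-J) := by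
  funext x
  rw [ellMinus, ellPlus, mul_neg, sub_neg_eq_add]

/-- The spherical coefficients of `ℓ^{+,J}` at a non-real point `q`. -/
noncomputable def ellPlusCoeff (J q : ℍ[ℝ]) : ℕ → ℍ[ℝ] :=
  Pi.single 0 ((1 / 2 : ℝ) • 1) + fun n => unitImCoeff q n * -((1 / 2 : ℝ) • J)

lemma ellPlusCoeff_zero (J q : ℍ[ℝ]) : ellPlusCoeff J q 0 = (1 / 2 : ℝ) • (1 - unitIm q * J) := by
  simp [ellPlusCoeff, unitImCoeff, coeffConst_zero, sub_eq_add_neg]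

lemma ellPlusCoeff_two_mul (J q : ℍ[ℝ]) {k : ℕ} (hk : 1 ≤ k) : ellPlusCoeff J q (2 * k) =
    -((coeffConst k * (1 / ‖q.im‖ ^ (2 * k))) • (unitIm q * J)) := by
  rw [ellPlusCoeff, Pi.add_apply, unitImCoeff_two_mul, Pi.single_eq_of_ne (by omega), zero_add,
    mul_neg, smul_mul_smul_comm]
  congr 2
  ring

lemma ellPlusCoeff_two_mul_add_one (J q : ℍ[ℝ]) (k : ℕ) : ellPlusCoeff J q (2 * k + 1) =
    -((coeffConst k * (1 / ‖q.im‖ ^ (2 * k + 1))) • J) := by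
  rw [ellPlusCoeff, Pi.add_apply, unitImCoeff_two_mul_add_one,
    Pi.single_eq_of_ne (by omega), zero_add, mul_neg, smul_mul_smul_comm, one_mul]
  congr 2
  ring

lemma eq_ellPlusCoeff_iff {J : ℍ[ℝ]} {s : ℕ → ℍ[ℝ]} :
    s = ellPlusCoeff J q ↔ s 0 = (1 / 2 : ℝ) • (1 - unitIm q * J) ∧
      (∀ k : ℕ, 1 ≤ k →
        s (2 * k) = -((coeffConst k * (1 / ‖q.im‖ ^ (2 * k))) • (unitIm q * J))) ∧
      (∀ k : ℕ, s (2 * k + 1) = -((coeffConst k * (1 / ‖q.im‖ ^ (2 * k + 1))) • J)) := by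
  constructor
  · rintro rfl
    exact ⟨ellPlusCoeff_zero J q, fun k => ellPlusCoeff_two_mul J q,
      ellPlusCoeff_two_mul_add_one J q⟩
  · rintro ⟨hzero, heven, hodd⟩
    funext n
    obtain ⟨k, rfl | rfl⟩ := n.even_or_odd'
    · rcases Nat.eq_zero_or_pos k with rfl | hk
      · exact hzero.trans (ellPlusCoeff_zero J q).symm
      · exact (heven k hk).trans (ellPlusCoeff_two_mul J q hk).symm
    · exact (hodd k).trans (ellPlusCoeff_two_mul_add_one J q k).symm

theorem hasSphericalExpansionOn_ellPlus (J : ℍ[ℝ]) {R : ℝ} (hq : q ∈ nonReal)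
    (hR : cassiniBall q R ⊆ nonReal) :
    HasSphericalExpansionOn (cassiniBall q R) (ellPlus J) q (ellPlusCoeff J q) := by
  rw [ellPlus_eq_const_add_unitIm_mul]
  exact (hasSphericalExpansionOn_unitIm hq hR).const_add_mul _ _

theorem isSphericalCoeffs_ellPlus_iff (J : ℍ[ℝ]) (hq : q ∈ nonReal) {s : ℕ → ℍ[ℝ]} :
    IsSphericalCoeffs nonReal (ellPlus J) q s ↔ s = ellPlusCoeff J q := by
  have hregular : IsSliceRegularOn nonReal (ellPlus J) := by
    rw [ellPlus_eq_const_add_unitIm_mul]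
    exact isSliceRegularOn_unitIm.const_add_mul _ _
  have hball : cassiniBall q ‖q.im‖ ⊆ nonReal := cassiniBall_subset_nonReal_iff.2 le_rfl
  have hcoeff : IsSphericalCoeffs nonReal (ellPlus J) q (ellPlusCoeff J q) :=
    ⟨hregular, ⟨hq, hq⟩, ‖q.im‖, norm_im_pos hq, hball, hasSphericalExpansionOn_ellPlus J hq hball⟩
  exact ⟨fun h => h.unique hcoeff, fun h => h ▸ hcoeff⟩

end EllPlus

end SliceReg

theorem corollary4p5_general (J I : ℍ[ℝ]) (hI : I ∈ SliceReg.imUnits)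
    (α β : ℝ) (hβ : 0 < β) (q : ℍ[ℝ]) (hq : q = (α : ℍ[ℝ]) + I * (β : ℍ[ℝ])) :
    (∀ s : ℕ → ℍ[ℝ], SliceReg.IsSphericalCoeffs SliceReg.nonReal (SliceReg.ellPlus J) q s ↔
      s 0 = (1 / 2 : ℝ) • (1 - I * J) ∧
      (∀ k : ℕ, 1 ≤ k → s (2 * k) = -((SliceReg.coeffConst k * (1 / β ^ (2 * k))) • (I * J))) ∧
      (∀ k : ℕ, s (2 * k + 1) = -((SliceReg.coeffConst k * (1 / β ^ (2 * k + 1))) • J))) ∧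
    (∀ s : ℕ → ℍ[ℝ], SliceReg.IsSphericalCoeffs SliceReg.nonReal (SliceReg.ellMinus J) q s ↔
      s 0 = (1 / 2 : ℝ) • (1 + I * J) ∧
      (∀ k : ℕ, 1 ≤ k → s (2 * k) = (SliceReg.coeffConst k * (1 / β ^ (2 * k))) • (I * J)) ∧
      (∀ k : ℕ, s (2 * k + 1) = (SliceReg.coeffConst k * (1 / β ^ (2 * k + 1))) • J)) ∧
    (∀ R : ℝ, SliceReg.cassiniBall q R ⊆ SliceReg.nonReal → ∀ s : ℕ → ℍ[ℝ],
      (SliceReg.IsSphericalCoeffs SliceReg.nonReal (SliceReg.ellPlus J) q s →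
        SliceReg.HasSphericalExpansionOn (SliceReg.cassiniBall q R) (SliceReg.ellPlus J) q s) ∧
      (SliceReg.IsSphericalCoeffs SliceReg.nonReal (SliceReg.ellMinus J) q s →
        SliceReg.HasSphericalExpansionOn (SliceReg.cassiniBall q R) (SliceReg.ellMinus J)
          q s)) := by
  have hqn : q ∈ SliceReg.nonReal := hq ▸ SliceReg.add_mul_mem_nonReal hI α hβ.ne'
  have hunit : SliceReg.unitIm q = I := by simp [hq, SliceReg.unitIm_add_mul hI, hβ]
  have hnorm : ‖q.im‖ = β := by rw [hq, SliceReg.norm_im_add_mul hI, abs_of_pos hβ]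
  simp only [SliceReg.ellMinus_eq_ellPlus_neg, SliceReg.isSphericalCoeffs_ellPlus_iff _ hqn]
  refine ⟨fun s => ?_, fun s => ?_, fun R hR s => ⟨?_, ?_⟩⟩
  · rw [SliceReg.eq_ellPlusCoeff_iff, hunit, hnorm]
  · rw [SliceReg.eq_ellPlusCoeff_iff, hunit, hnorm]
    simp only [mul_neg, sub_neg_eq_add, smul_neg, neg_neg]
  all_goals
    rintro rfl
    exact SliceReg.hasSphericalExpansionOn_ellPlus _ hqn hR

theorem corollary4p5 (J I : ℍ[ℝ]) (hJ : J ∈ SliceReg.imUnits) (hI : I ∈ SliceReg.imUnits)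
    (α β : ℝ) (hβ : 0 < β) (q : ℍ[ℝ]) (hq : q = (α : ℍ[ℝ]) + I * (β : ℍ[ℝ])) :
    -- the spherical coefficients of `ℓ^{+,J}` at `q` exist, are unique, and are the following
    (∀ s : ℕ → ℍ[ℝ], SliceReg.IsSphericalCoeffs SliceReg.nonReal (SliceReg.ellPlus J) q s ↔
      s 0 = (1 / 2 : ℝ) • (1 - I * J) ∧
      (∀ k : ℕ, 1 ≤ k → s (2 * k) = -((SliceReg.coeffConst k * (1 / β ^ (2 * k))) • (I * J))) ∧
      (∀ k : ℕ, s (2 * k + 1) = -((SliceReg.coeffConst k * (1 / β ^ (2 * k + 1))) • J))) ∧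
    -- the spherical coefficients of `ℓ^{-,J}` at `q` exist, are unique, and are the following
    (∀ s : ℕ → ℍ[ℝ], SliceReg.IsSphericalCoeffs SliceReg.nonReal (SliceReg.ellMinus J) q s ↔
      s 0 = (1 / 2 : ℝ) • (1 + I * J) ∧
      (∀ k : ℕ, 1 ≤ k → s (2 * k) = (SliceReg.coeffConst k * (1 / β ^ (2 * k))) • (I * J)) ∧
      (∀ k : ℕ, s (2 * k + 1) = (SliceReg.coeffConst k * (1 / β ^ (2 * k + 1))) • J)) ∧
    -- the expansions are valid on every Cassini ball around `q` contained in `ℍ ∖ ℝ`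
    (∀ R : ℝ, 0 < R → SliceReg.cassiniBall q R ⊆ SliceReg.nonReal → ∀ s : ℕ → ℍ[ℝ],
      (SliceReg.IsSphericalCoeffs SliceReg.nonReal (SliceReg.ellPlus J) q s →
        SliceReg.HasSphericalExpansionOn (SliceReg.cassiniBall q R) (SliceReg.ellPlus J) q s) ∧
      (SliceReg.IsSphericalCoeffs SliceReg.nonReal (SliceReg.ellMinus J) q s →
        SliceReg.HasSphericalExpansionOn (SliceReg.cassiniBall q R) (SliceReg.ellMinus J) q s)) :=
  let ⟨hplus, hminus, hball⟩ := corollary4p5_general J I hI α β hβ q hq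
  ⟨hplus, hminus, fun R _ => hball R⟩
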